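/- Let $k$ be an algebraically closed field, and let $A$ and $B$ be finite-dimensional associative commutative $k$-algebras, not assumed to have a unit. Let $\Omega$ be the category whose objects are the sets $\underline{n}=\{1,\dots,n\}$, $n=0,1,2,\dots$, and whose morphisms are the surjective maps. For an associative commutative $k$-algebra $A$, not assumed to have a unit, let $L_A\colon\Omega\to k\text{-}\mathrm{Mod}$ be the functor with $L_A(\underline{n})=A^{\otimes n}$ (tensor power over $k$, $A^{\otimes 0}=k$) that sends a surjection $h\colon\underline{m}\to\underline{n}$ to the linear map $$L_A(h)\colon x_1\otimes\cdots\otimes x_m\mapsto y_1\otimes\cdots\otimes y_n,\qquad y_j=\prod_{i\in h^{-1}(j)}x_i .$$ Then the functors $L_A$ and $L_B$ are (naturally) isomorphic if and only if $A$ and $B$ are isomorphic as $k$-algebras, i.e. there is a $k$-linear bijection $e\colon A\to B$ with $e(xy)=e(x)e(y)$ for all $x,y\in A$. -/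

import Mathlib

open CategoryTheory
open scoped TensorProduct

universe u v

/-- The category `Ω`: its objects are the finite sets `{1, …, n}`, `n = 0, 1, 2, …`
(modelled by `Fin n`), and its morphisms are the surjective maps. -/
structure SurjCat : Type where
  /-- the number of elements -/
  card : ℕ

namespace SurjCat

instance : Category SurjCat where
  Hom m n := {h : Fin m.card → Fin n.card // Function.Surjective h}
  id n := ⟨id, Function.surjective_id⟩
  comp f g := ⟨g.1 ∘ f.1, g.2.comp f.2⟩

end SurjCat

namespace Loday

section Product

variable (k : Type u) [Field k] {A : Type v} [NonUnitalCommRing A] [Module k A]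
  [IsScalarTower k A A] [SMulCommClass k A A] {ι : Type*}

/-- The product `∏_{i ∈ s} x i` in a commutative algebra `A` without unity, for a nonempty finite
set `s`. It is computed in the unitization `k ⊕ A`; for nonempty `s` the product taken there lies
in `A` (see `inr_prod`), and it is characterised by `prod_singleton` and `prod_cons`. -/
noncomputable def prod (s : Finset ι) (x : ι → A) : A :=
  (∏ i ∈ s, (Unitization.inr (x i) : Unitization k A)).snd

theorem inr_prod {s : Finset ι} (hs : s.Nonempty) (x : ι → A) :
    (Unitization.inr (prod k s x) : Unitization k A) = ∏ i ∈ s, Unitization.inr (x i) := by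
  have h : (∏ i ∈ s, (Unitization.inr (x i) : Unitization k A)).fst = 0 := by
    obtain ⟨i, hi⟩ := hs
    have := map_prod (Unitization.fstHom k A) (fun i => (Unitization.inr (x i))) s
    simp only [Unitization.fstHom_apply, Unitization.fst_inr] at this
    rw [this]
    exact Finset.prod_eq_zero hi rfl
  exact Unitization.ext (by simp [h]) (by simp [prod])

theorem prod_singleton (i : ι) (x : ι → A) : prod k {i} x = x i := by
  simp [prod]

theorem prod_cons {s : Finset ι} (hs : s.Nonempty) {a : ι} (ha : a ∉ s) (x : ι → A) :
    prod k (Finset.cons a s ha) x = x a * prod k s x := by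
  apply Unitization.inr_injective (R := k)
  rw [Unitization.inr_mul, inr_prod k hs, inr_prod k (Finset.cons_nonempty ha),
    Finset.prod_cons]

theorem prod_update_of_mem [DecidableEq ι] {s : Finset ι} {i : ι} (hi : i ∈ s) (x : ι → A)
    (a : A) :
    prod k s (Function.update x i a) =
      ((Unitization.inr a : Unitization k A) *
        ∏ j ∈ s.erase i, (Unitization.inr (x j) : Unitization k A)).snd := by
  rw [prod, ← Finset.mul_prod_erase s _ hi, Function.update_self]
  rw [Finset.prod_congr rfl fun j (hj : j ∈ s.erase i) =>
    congrArg Unitization.inr (Function.update_of_ne (Finset.ne_of_mem_erase hj) a x)]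

theorem prod_update_of_notMem [DecidableEq ι] {s : Finset ι} {i : ι} (hi : i ∉ s) (x : ι → A)
    (a : A) : prod k s (Function.update x i a) = prod k s x := by
  rw [prod, prod, Finset.prod_congr rfl fun j (hj : j ∈ s) =>
    congrArg Unitization.inr (Function.update_of_ne (ne_of_mem_of_not_mem hj hi) a x)]

end Product

section Functor

variable (k : Type u) [Field k] (A : Type v) [NonUnitalCommRing A] [Module k A]
  [IsScalarTower k A A] [SMulCommClass k A A]

/-- For `x = (x_1, …, x_m)` and `h : {1, …, m} → {1, …, n}`, the family `(y_1, …, y_n)` with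
`y_j = ∏_{i ∈ h⁻¹(j)} x_i`. -/
noncomputable def fibreProd {m n : ℕ} (h : Fin m → Fin n) (x : Fin m → A) (j : Fin n) : A :=
  prod k (Finset.univ.filter fun i => h i = j) x

theorem fibreProd_update {m n : ℕ} (h : Fin m → Fin n) [DecidableEq (Fin m)] (x : Fin m → A)
    (i : Fin m) (a : A) :
    fibreProd k A h (Function.update x i a) =
      Function.update (fibreProd k A h x) (h i)
        ((Unitization.inr a : Unitization k A) *
          ∏ j ∈ (Finset.univ.filter fun l => h l = h i).erase i,
            (Unitization.inr (x j) : Unitization k A)).snd := by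
  funext j
  by_cases hj : j = h i
  · subst hj
    rw [Function.update_self, fibreProd, prod_update_of_mem k (by simp)]
  · rw [Function.update_of_ne hj, fibreProd, fibreProd, prod_update_of_notMem]
    simpa using fun e => hj e.symm

/-- The multilinear map `(x_1, …, x_m) ↦ y_1 ⊗ ⋯ ⊗ y_n`, `y_j = ∏_{i ∈ h⁻¹(j)} x_i`. -/
noncomputable def multilinear {m n : ℕ} (h : Fin m → Fin n) :
    MultilinearMap k (fun _ : Fin m => A) (⨂[k] _ : Fin n, A) where
  toFun x := PiTensorProduct.tprod k (fibreProd k A h x)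
  map_update_add' x i a b := by
    simp only [fibreProd_update, Unitization.inr_add, add_mul, Unitization.snd_add,
      MultilinearMap.map_update_add]
  map_update_smul' x i c a := by
    simp only [fibreProd_update, Unitization.inr_smul, smul_mul_assoc, Unitization.snd_smul,
      MultilinearMap.map_update_smul]

/-- The linear map `A^{⊗m} → A^{⊗n}`, `x_1 ⊗ ⋯ ⊗ x_m ↦ y_1 ⊗ ⋯ ⊗ y_n`, where
`y_j = ∏_{i ∈ h⁻¹(j)} x_i`. -/
noncomputable def map {m n : ℕ} (h : Fin m → Fin n) :
    (⨂[k] _ : Fin m, A) →ₗ[k] (⨂[k] _ : Fin n, A) :=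
  PiTensorProduct.lift (multilinear k A h)

theorem map_tprod {m n : ℕ} (h : Fin m → Fin n) (x : Fin m → A) :
    map k A h (PiTensorProduct.tprod k x) = PiTensorProduct.tprod k (fibreProd k A h x) :=
  PiTensorProduct.lift.tprod x

theorem fibreProd_id {n : ℕ} (x : Fin n → A) : fibreProd k A id x = x := by
  funext j
  have : (Finset.univ.filter fun i : Fin n => id i = j) = {j} := by ext; simp
  rw [fibreProd, this, prod_singleton]

theorem fibreProd_comp {l m n : ℕ} (f : Fin l → Fin m) (g : Fin m → Fin n)
    (hf : Function.Surjective f) (hg : Function.Surjective g) (x : Fin l → A) :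
    fibreProd k A (g ∘ f) x = fibreProd k A g (fibreProd k A f x) := by
  funext j
  have ne {a b : ℕ} (p : Fin a → Fin b) (hp : Function.Surjective p) (j : Fin b) :
      (Finset.univ.filter fun i => p i = j).Nonempty := by
    obtain ⟨i, hi⟩ := hp j
    exact ⟨i, by simpa using hi⟩
  apply Unitization.inr_injective (R := k)
  simp only [fibreProd]
  rw [inr_prod k (ne _ (hg.comp hf) j), inr_prod k (ne _ hg j)]
  rw [← Finset.prod_fiberwise_of_maps_to (g := f)
    (t := Finset.univ.filter fun i => g i = j) (by simp)]
  refine Finset.prod_congr rfl fun b hb => Eq.trans ?_ (inr_prod k (ne _ hf b) x).symm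
  refine Finset.prod_congr ?_ fun _ _ => rfl
  ext i
  simp only [Finset.mem_filter, Finset.mem_univ, true_and, Function.comp_apply] at hb ⊢
  exact ⟨fun h => h.2, fun h => ⟨by rw [h, hb], h⟩⟩

/-- The Loday-type functor `L_A : Ω → k-Mod`: `L_A({1, …, n}) = A^{⊗n}`, and a surjection
`h : {1, …, m} → {1, …, n}` is sent to `x_1 ⊗ ⋯ ⊗ x_m ↦ y_1 ⊗ ⋯ ⊗ y_n`, where
`y_j = ∏_{i ∈ h⁻¹(j)} x_i`. -/
noncomputable def functor : SurjCat ⥤ ModuleCat.{max u v} k where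
  obj n := ModuleCat.of k (⨂[k] _ : Fin n.card, A)
  map h := ModuleCat.ofHom (map k A h.1)
  map_id n := by
    apply ModuleCat.hom_ext
    apply PiTensorProduct.ext
    ext x
    change map k A id (PiTensorProduct.tprod k x) = PiTensorProduct.tprod k x
    rw [map_tprod, fibreProd_id]
  map_comp f g := by
    apply ModuleCat.hom_ext
    apply PiTensorProduct.ext
    ext x
    change map k A (g.1 ∘ f.1) (PiTensorProduct.tprod k x) =
      map k A g.1 (map k A f.1 (PiTensorProduct.tprod k x))
    rw [map_tprod, map_tprod, map_tprod, fibreProd_comp k A f.1 g.1 f.2 g.2]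

end Functor

end Loday

/-!
An isomorphism of algebras clearly induces a natural isomorphism of functors. The converse is not
obvious, since a natural isomorphism `L_A ≅ L_B` need not be compatible with tensor products; it
rests on a description of all natural transformations `η : L_A → L_B`.

Choose bases of `A` and `B`, and let `k[X_{ij}]` be the ring of polynomial functions on the space
of linear maps `A → B`. Naturality with respect to permutations says that the matrix entries of the
components `A^{⊗n} → B^{⊗n}` depend only on the monomial `X_{i_1 j_1} ⋯ X_{i_n j_n}`, so that `η`
amounts to a linear functional on `k[X_{ij}]` (`functional`, `functional_prod_X`). Naturality with
respect to the surjections which identify two points says that this functional vanishes on the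
ideal `I` generated by the equations `e(xy) = e(x)e(y)` for a linear map `e : A → B`
(`functional_eq_zero_of_mem`).

Let `η` be an isomorphism. Its component at the one-point set shows that `A` and `B` have the same
dimension, so the generic matrix `X` is square. If no linear bijection `A → B` is
multiplicative, `det X` vanishes at all zeros of `I`, and the Nullstellensatz gives `N` with
`(det X)^N ∈ I` (`exists_det_pow_mem`). Consider the tensor power `ω^{⊗N}` of the antisymmetric
tensor `ω = ∑ σ, sign σ • a_{σ 1} ⊗ ⋯ ⊗ a_{σ d}` of top degree. Each coordinate of its image under
`η` is the value of the functional at a product of `N` determinants of matrices made of columns of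
`X` (`tensorCoord_component_antisymmTensor`). All these products are multiples of `(det X)^N`, so
`η` kills `ω^{⊗N}`. But `ω^{⊗N}` has a coordinate equal to `1`, and `η` is injective: a
contradiction. The argument works in every characteristic.
-/

open Module MvPolynomial

namespace Loday

/-! ### Algebra isomorphisms induce natural isomorphisms -/

section OfAlgEquiv

variable {k : Type u} [Field k] {A B : Type v}
  [NonUnitalCommRing A] [Module k A] [IsScalarTower k A A] [SMulCommClass k A A]
  [NonUnitalCommRing B] [Module k B] [IsScalarTower k B B] [SMulCommClass k B B]

theorem apply_prod {ι : Type*} (e : A →ₗ[k] B) (he : ∀ x y : A, e (x * y) = e x * e y)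
    {s : Finset ι} (hs : s.Nonempty) (x : ι → A) :
    e (prod k s x) = prod k s fun i => e (x i) := by
  induction hs using Finset.Nonempty.cons_induction with
  | singleton a => rw [prod_singleton, prod_singleton]
  | cons a s ha hs ih => rw [prod_cons k hs ha, prod_cons k hs ha, he, ih]

theorem filter_fibre_nonempty {m n : ℕ} {h : Fin m → Fin n} (hh : Function.Surjective h)
    (j : Fin n) : (Finset.univ.filter fun i => h i = j).Nonempty := by
  obtain ⟨i, hi⟩ := hh j
  exact ⟨i, by simpa using hi⟩

theorem nonempty_iso_of_algEquiv (e : A ≃ₗ[k] B) (he : ∀ x y : A, e (x * y) = e x * e y) :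
    Nonempty (functor k A ≅ functor k B) := by
  refine ⟨NatIso.ofComponents
    (fun n => (PiTensorProduct.congr fun _ : Fin n.card => e).toModuleIso) fun {m n} h => ?_⟩
  apply ModuleCat.hom_ext
  apply PiTensorProduct.ext
  ext x
  change PiTensorProduct.congr (fun _ => e) (map k A h.1 (PiTensorProduct.tprod k x)) =
    map k B h.1 (PiTensorProduct.congr (fun _ => e) (PiTensorProduct.tprod k x))
  rw [map_tprod, PiTensorProduct.congr_tprod, PiTensorProduct.congr_tprod, map_tprod]
  congr 1
  funext j
  exact apply_prod e.toLinearMap he (filter_fibre_nonempty h.2 j) x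

end OfAlgEquiv

/-! ### Monomials as words in the variables -/

section Words

variable {σ : Type*}

/-- Every exponent vector is the exponent vector of a word in the variables. -/
theorem exists_sum_single_eq (m : σ →₀ ℕ) :
    ∃ (n : ℕ) (v : Fin n → σ), ∑ t, Finsupp.single (v t) 1 = m := by
  induction m using Finsupp.induction_linear with
  | zero => exact ⟨0, Fin.elim0, by simp⟩
  | add f g hf hg =>
    obtain ⟨n, v, rfl⟩ := hf
    obtain ⟨n', v', rfl⟩ := hg
    exact ⟨n + n', Fin.append v v', by simp [Fin.sum_univ_add]⟩
  | single a c => exact ⟨c, fun _ => a, by simp⟩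

/-- Words with the same exponent vector differ by a permutation of their positions. -/
theorem exists_equiv_of_sum_single_eq {S T : Type*} [Fintype S] [Fintype T] {v : S → σ}
    {w : T → σ} (h : ∑ s, Finsupp.single (v s) 1 = ∑ t, Finsupp.single (w t) (1 : ℕ)) :
    ∃ e : S ≃ T, ∀ s, w (e s) = v s := by
  classical
  -- The exponent of a letter counts its occurrences, so both words use it equally often.
  have card (a : σ) : Nonempty ({s // v s = a} ≃ {t // w t = a}) := by
    rw [← Fintype.card_eq, Fintype.card_subtype, Fintype.card_subtype]
    simpa [Finsupp.finsetSum_apply, Finsupp.single_apply] using DFunLike.congr_fun h a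
  exact ⟨Equiv.ofFiberEquiv fun a => (card a).some, fun s => Equiv.ofFiberEquiv_map _ s⟩

theorem basisMonomials_sum_single {R : Type*} [CommSemiring R] {n : ℕ} (v : Fin n → σ) :
    basisMonomials σ R (∑ t, Finsupp.single (v t) 1) = ∏ t, X (v t) := by
  rw [coe_basisMonomials]
  exact monomial_sum_one _ _

end Words

/-! ### Coordinates of tensors -/

section Coordinates

variable {k : Type u} [Field k]

section Module

variable {M : Type v} [AddCommGroup M] [Module k M]

/-- The coordinate of a tensor at the basis element `b (v 1) ⊗ ⋯ ⊗ b (v n)`. -/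
noncomputable def tensorCoord {κ : Type*} (b : Basis κ k M) {n : ℕ} (v : Fin n → κ) :
    (⨂[k] _ : Fin n, M) →ₗ[k] k :=
  (_root_.Basis.piTensorProduct fun _ : Fin n => b).coord v

theorem tensorCoord_tprod {κ : Type*} (b : Basis κ k M) {n : ℕ} (v : Fin n → κ) (x : Fin n → M) :
    tensorCoord b v (PiTensorProduct.tprod k x) = ∏ t, b.repr (x t) (v t) := by
  simp [tensorCoord]

theorem eq_zero_of_tensorCoord {κ : Type*} (b : Basis κ k M) {n : ℕ} {z : ⨂[k] _ : Fin n, M}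
    (h : ∀ v, tensorCoord b v z = 0) : z = 0 :=
  (_root_.Basis.piTensorProduct fun _ : Fin n => b).ext_elem fun v => by
    simpa [tensorCoord] using h v

end Module

variable {A : Type v} [NonUnitalCommRing A] [Module k A]
  [IsScalarTower k A A] [SMulCommClass k A A]

theorem fibreProd_equiv {m n : ℕ} (e : Fin m ≃ Fin n) (x : Fin m → A) :
    fibreProd k A e x = x ∘ e.symm := by
  funext j
  have : (Finset.univ.filter fun i => e i = j) = {e.symm j} := by
    ext i; simp [Equiv.eq_symm_apply]
  rw [fibreProd, this, prod_singleton, Function.comp_apply]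

theorem tensorCoord_map_equiv {κ : Type*} (b : Basis κ k A) {m n : ℕ} (e : Fin m ≃ Fin n)
    (v : Fin n → κ) (z : ⨂[k] _ : Fin m, A) :
    tensorCoord b v (map k A e z) = tensorCoord b (v ∘ e) z := by
  suffices tensorCoord b v ∘ₗ map k A e = tensorCoord b (v ∘ e) from LinearMap.congr_fun this z
  apply PiTensorProduct.ext
  ext x
  simp only [LinearMap.compMultilinearMap_apply, LinearMap.comp_apply, map_tprod,
    tensorCoord_tprod, fibreProd_equiv]
  exact (Fintype.prod_equiv e _ _ fun t => by simp).symm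

/-- The surjection `{0, …, n + 1} → {0, …, n}` which identifies `0` and `1`. -/
def merge (n : ℕ) : Fin (n + 2) → Fin (n + 1) :=
  Fin.cons 0 id

@[simp]
theorem merge_zero (n : ℕ) : merge n 0 = 0 :=
  rfl

@[simp]
theorem merge_succ (n : ℕ) (i : Fin (n + 1)) : merge n i.succ = i :=
  rfl

theorem merge_surjective (n : ℕ) : Function.Surjective (merge n) :=
  fun j => ⟨j.succ, merge_succ n j⟩

theorem fibreProd_merge {n : ℕ} (x y : A) (z : Fin n → A) :
    fibreProd k A (merge n) (Fin.cons x (Fin.cons y z : Fin (n + 1) → A)) =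
      Fin.cons (x * y) z := by
  funext j
  refine Fin.cases ?_ (fun j => ?_) j
  · have : (Finset.univ.filter fun i => merge n i = 0) =
        Finset.cons 0 {Fin.succ 0} (by simp) := by
      ext i
      refine Fin.cases (by simp) (fun i => ?_) i
      rw [Finset.mem_filter_univ, Finset.mem_cons, Finset.mem_singleton, merge_succ, Fin.succ_inj]
      simp [Fin.succ_ne_zero]
    rw [fibreProd, this, prod_cons k (by simp), prod_singleton]
    rfl
  · have : (Finset.univ.filter fun i => merge n i = j.succ) = {j.succ.succ} := by
      ext i
      refine Fin.cases ?_ (fun i => ?_) i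
      · simp [(Fin.succ_ne_zero _).symm]
      · simp
    rw [fibreProd, this, prod_singleton]
    rfl

/-- The functional dual to `map k A (merge n)`: expand the product of the first two factors by
the structure constants of the algebra. -/
theorem tensorCoord_map_merge {κ : Type*} [Fintype κ] (b : Basis κ k A) {n : ℕ} (l : κ)
    (w : Fin n → κ) (z : ⨂[k] _ : Fin (n + 2), A) :
    tensorCoord b (Fin.cons l w : Fin (n + 1) → κ) (map k A (merge n) z) =
      ∑ j, ∑ j', b.repr (b j * b j') l *
        tensorCoord b (Fin.cons j (Fin.cons j' w : Fin (n + 1) → κ) : Fin (n + 2) → κ) z := by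
  suffices tensorCoord b (Fin.cons l w : Fin (n + 1) → κ) ∘ₗ map k A (merge n) =
      ∑ j, ∑ j', b.repr (b j * b j') l •
        tensorCoord b (Fin.cons j (Fin.cons j' w : Fin (n + 1) → κ) : Fin (n + 2) → κ) by
    simpa using LinearMap.congr_fun this z
  apply PiTensorProduct.ext
  ext x
  obtain ⟨x, y, z, rfl⟩ : ∃ (x₀ x₁ : A) (z : Fin n → A),
      x = Fin.cons x₀ (Fin.cons x₁ z : Fin (n + 1) → A) :=
    ⟨x 0, x 1, fun i => x i.succ.succ, by
      funext i
      exact Fin.cases rfl (fun i => Fin.cases rfl (fun i => rfl) i) i⟩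
  simp only [LinearMap.compMultilinearMap_apply, LinearMap.comp_apply, map_tprod,
    tensorCoord_tprod, fibreProd_merge, LinearMap.sum_apply, LinearMap.smul_apply, smul_eq_mul,
    Fin.prod_univ_succ, Fin.cons_zero, Fin.cons_succ]
  have hxy : b.repr (x * y) l = ∑ j, ∑ j', b.repr (b j * b j') l * (b.repr x j * b.repr y j') := by
    conv_lhs => rw [← b.sum_repr x, ← b.sum_repr y]
    simp only [Finset.sum_mul_sum, smul_mul_smul_comm, map_sum, map_smul,
      Finsupp.finsetSum_apply, Finsupp.smul_apply, smul_eq_mul]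
    exact Finset.sum_congr rfl fun j _ => Finset.sum_congr rfl fun j' _ => mul_comm _ _
  rw [hxy]
  simp only [Finset.sum_mul]
  exact Finset.sum_congr rfl fun j _ => Finset.sum_congr rfl fun j' _ => by ring

end Coordinates

/-! ### The functional on polynomials defined by a natural transformation -/

section Functional

variable {k : Type u} [Field k] {A B : Type v}
  [NonUnitalCommRing A] [Module k A] [IsScalarTower k A A] [SMulCommClass k A A]
  [NonUnitalCommRing B] [Module k B] [IsScalarTower k B B] [SMulCommClass k B B]

/-- The component `A^{⊗n} → B^{⊗n}` of a natural transformation `L_A → L_B`, as a linear map. -/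
noncomputable def component (η : functor k A ⟶ functor k B) (n : ℕ) :
    (⨂[k] _ : Fin n, A) →ₗ[k] (⨂[k] _ : Fin n, B) :=
  (η.app ⟨n⟩).hom

theorem component_map (η : functor k A ⟶ functor k B) {m n : ℕ} {h : Fin m → Fin n}
    (hh : Function.Surjective h) (z : ⨂[k] _ : Fin m, A) :
    component η n (map k A h z) = map k B h (component η m z) :=
  LinearMap.congr_fun (congrArg ModuleCat.Hom.hom
    (η.naturality (X := ⟨m⟩) (Y := ⟨n⟩) ⟨h, hh⟩)) z

theorem component_comp_inv (η : functor k A ≅ functor k B) (n : ℕ) (z : ⨂[k] _ : Fin n, B) :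
    component η.hom n (component η.inv n z) = z :=
  LinearMap.congr_fun (congrArg ModuleCat.Hom.hom (η.inv_hom_id_app ⟨n⟩)) z

theorem component_inv_comp (η : functor k A ≅ functor k B) (n : ℕ) (z : ⨂[k] _ : Fin n, A) :
    component η.inv n (component η.hom n z) = z :=
  LinearMap.congr_fun (congrArg ModuleCat.Hom.hom (η.hom_inv_id_app ⟨n⟩)) z

variable {ι κ : Type*} (a : Basis ι k A) (b : Basis κ k B) (η : functor k A ⟶ functor k B)

/-- The matrix entry of the `n`-th component of `η` at the basis tensors given by a word
`(i_1, j_1), …, (i_n, j_n)`. -/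
noncomputable def wordCoeff {n : ℕ} (v : Fin n → ι × κ) : k :=
  tensorCoord b (fun t => (v t).2)
    (component η n (PiTensorProduct.tprod k fun t => a (v t).1))

/-- Matrix entries do not depend on the order of the letters, because `η` commutes with the
symmetric groups. -/
theorem wordCoeff_comp_equiv {m n : ℕ} (e : Fin m ≃ Fin n) (v : Fin n → ι × κ) :
    wordCoeff a b η (v ∘ e) = wordCoeff a b η v := by
  have h := tensorCoord_map_equiv b e (fun t => (v t).2)
    (component η m (PiTensorProduct.tprod k fun t => a (v (e t)).1))
  rw [← component_map η e.surjective, map_tprod, fibreProd_equiv] at h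
  rw [wordCoeff, wordCoeff]
  refine Eq.trans h.symm ?_
  congr 3
  funext t
  simp

/-- The linear functional on `k[X_{ij}]`, the coordinate ring of the space of linear maps
`A → B`, corresponding to a natural transformation `L_A → L_B`: its value at the monomial of a
word is the matrix entry of the word. The definition chooses a word for each monomial; by
`functional_prod_X` the choice does not matter. -/
noncomputable def functional : MvPolynomial (ι × κ) k →ₗ[k] k :=
  (basisMonomials (ι × κ) k).constr k fun m =>
    wordCoeff a b η (exists_sum_single_eq m).choose_spec.choose

theorem functional_prod_X {n : ℕ} (v : Fin n → ι × κ) :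
    functional a b η (∏ t, X (v t)) = wordCoeff a b η v := by
  rw [← basisMonomials_sum_single, functional, Basis.constr_basis]
  obtain ⟨e, he⟩ := exists_equiv_of_sum_single_eq
    (exists_sum_single_eq (∑ t, Finsupp.single (v t) 1)).choose_spec.choose_spec
  rw [← wordCoeff_comp_equiv a b η e v]
  exact congrArg _ (funext fun s => (he s).symm)

variable [Fintype ι] [Fintype κ]

/-- The equation `e (a i * a i') = e (a i) * e (a i')` in the coordinate `l`, for the generic
linear map `e : A → B`, `e (a i) = ∑ j, X_{ij} b j`. -/
noncomputable def relation (i i' : ι) (l : κ) : MvPolynomial (ι × κ) k :=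
  ∑ p, a.repr (a i * a i') p • X (p, l) -
    ∑ j, ∑ j', b.repr (b j * b j') l • (X (i, j) * X (i', j'))

/-- The ideal of the scheme of multiplicative linear maps `A → B` in `k[X_{ij}]`. By bilinearity
it suffices to impose multiplicativity on basis vectors. -/
noncomputable def relationIdeal : Ideal (MvPolynomial (ι × κ) k) :=
  Ideal.span (Set.range fun q : ι × ι × κ => relation a b q.1 q.2.1 q.2.2)

/-- Naturality with respect to the surjections `merge n` says that the functional vanishes on
the monomial multiples of the relations. -/
theorem functional_relation_mul_prod_X (i i' : ι) (l : κ) {n : ℕ} (v : Fin n → ι × κ) :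
    functional a b η (relation a b i i' l * ∏ t, X (v t)) = 0 := by
  let x : Fin n → A := fun t => a (v t).1
  let w : Fin n → κ := fun t => (v t).2
  -- `curryLeft` displays the linear dependence on the first factor, so that the sum over `p` can be
  -- collected into the tensor with first factor `a i * a i'`.
  have h₁ (p : ι) : functional a b η (X (p, l) * ∏ t, X (v t)) =
      tensorCoord b (Fin.cons l w : Fin (n + 1) → κ)
        (component η (n + 1) ((PiTensorProduct.tprod k).curryLeft (a p) x)) := by
    have := functional_prod_X a b η (Fin.cons (p, l) v : Fin (n + 1) → ι × κ)
    rw [Fin.prod_univ_succ] at this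
    refine this.trans ?_
    rw [wordCoeff, MultilinearMap.curryLeft_apply]
    congr 3
    · funext t; exact Fin.cases rfl (fun _ => rfl) t
    · funext t; exact Fin.cases rfl (fun _ => rfl) t
  have h₂ (j j' : κ) : functional a b η (X (i, j) * X (i', j') * ∏ t, X (v t)) =
      tensorCoord b (Fin.cons j (Fin.cons j' w : Fin (n + 1) → κ) : Fin (n + 2) → κ)
        (component η (n + 2) (PiTensorProduct.tprod k
          (Fin.cons (a i) (Fin.cons (a i') x : Fin (n + 1) → A)))) := by
    have := functional_prod_X a b η
      (Fin.cons (i, j) (Fin.cons (i', j') v : Fin (n + 1) → ι × κ) : Fin (n + 2) → ι × κ)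
    rw [Fin.prod_univ_succ, Fin.prod_univ_succ, ← mul_assoc] at this
    refine this.trans ?_
    rw [wordCoeff]
    congr 3
    · funext t; exact Fin.cases rfl (fun t => Fin.cases rfl (fun _ => rfl) t) t
    · funext t; exact Fin.cases rfl (fun t => Fin.cases rfl (fun _ => rfl) t) t
  rw [relation, sub_mul, map_sub, sub_eq_zero]
  simp only [Finset.sum_mul, smul_mul_assoc, map_sum, map_smul, h₁, h₂, smul_eq_mul]
  rw [← tensorCoord_map_merge, ← component_map η (merge_surjective n), map_tprod,
    fibreProd_merge]
  conv_rhs => rw [← MultilinearMap.curryLeft_apply, ← a.sum_repr (a i * a i')]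
  simp only [map_sum, map_smul, sum_apply, smul_apply, smul_eq_mul]

theorem functional_eq_zero_of_mem {p : MvPolynomial (ι × κ) k} (hp : p ∈ relationIdeal a b) :
    functional a b η p = 0 := by
  -- Quantifying over all multiples `p * q` makes the claim stable under multiplication by scalars
  -- from the polynomial ring.
  refine Submodule.span_induction (p := fun p _ => ∀ q, functional a b η (p * q) = 0)
    ?_ ?_ ?_ ?_ hp 1 |> fun h => by simpa using h
  · rintro _ ⟨⟨i, i', l⟩, rfl⟩ q
    suffices functional a b η ∘ₗ LinearMap.mulLeft k (relation a b i i' l) = 0 from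
      LinearMap.congr_fun this q
    refine (basisMonomials (ι × κ) k).ext fun m => ?_
    obtain ⟨n, v, rfl⟩ := exists_sum_single_eq m
    rw [basisMonomials_sum_single]
    exact functional_relation_mul_prod_X a b η i i' l v
  · simp
  · intro p p' _ _ h h' q
    rw [add_mul, map_add, h, h', add_zero]
  · intro r p _ h q
    rw [smul_eq_mul, mul_comm r, mul_assoc, h]

end Functional

/-! ### Invertible points of the scheme of multiplicative maps -/

section Points

variable {k : Type u} [Field k] {A B : Type v}
  [NonUnitalCommRing A] [Module k A] [IsScalarTower k A A] [SMulCommClass k A A]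
  [NonUnitalCommRing B] [Module k B] [IsScalarTower k B B] [SMulCommClass k B B]
  {ι : Type*} [Fintype ι] [DecidableEq ι] (a : Basis ι k A) (b : Basis ι k B)

theorem exists_algEquiv_of_mem_zeroLocus {p : ι × ι → k} (hp : p ∈ zeroLocus k (relationIdeal a b))
    (hdet : aeval p (Matrix.mvPolynomialX ι ι k).det ≠ 0) :
    ∃ e : A ≃ₗ[k] B, ∀ x y : A, e (x * y) = e x * e y := by
  -- The rows of the generic matrix are indexed by the basis of the source, the columns of the
  -- matrix of a linear map are: hence the transpose.
  let M : Matrix ι ι k := Matrix.of fun i j => p (j, i)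
  have hM : (LinearMap.toMatrix a b (Matrix.toLin a b M)).det = aeval p
      (Matrix.mvPolynomialX ι ι k).det := by
    rw [LinearMap.toMatrix_toLin, aeval_eq_eval, Matrix.eval_det_mvPolynomialX,
      ← Matrix.det_transpose]
    rfl
  let e : A ≃ₗ[k] B := LinearEquiv.ofIsUnitDet (hM ▸ hdet.isUnit)
  have he (i : ι) : e (a i) = ∑ j, p (i, j) • b j := by
    simp [e, LinearEquiv.ofIsUnitDet, Matrix.toLin_self, M]
  have hmul (i i' : ι) : e (a i * a i') = e (a i) * e (a i') := by
    refine b.ext_elem fun l => ?_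
    have h := hp _ (Ideal.subset_span ⟨(i, i', l), rfl⟩)
    simp only [relation, map_sub, map_sum, map_smul, map_mul, aeval_X, sub_eq_zero,
      smul_eq_mul] at h
    conv_lhs => rw [← a.sum_repr (a i * a i')]
    simp only [map_sum, map_smul, he, Finset.sum_mul_sum, smul_mul_smul_comm,
      Finsupp.finsetSum_apply, Finsupp.smul_apply, smul_eq_mul, b.repr_self]
    simpa [Finsupp.single_apply, mul_comm] using h
  refine ⟨e, fun x y => ?_⟩
  rw [← a.sum_repr x, ← a.sum_repr y]
  simp only [map_sum, map_smul, Finset.sum_mul_sum, smul_mul_smul_comm, hmul]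

/-- Nullstellensatz: without an invertible multiplicative map `A → B`, the generic determinant is
nilpotent on the scheme of multiplicative maps. -/
theorem exists_det_pow_mem [IsAlgClosed k]
    (h : ¬ ∃ e : A ≃ₗ[k] B, ∀ x y : A, e (x * y) = e x * e y) :
    ∃ N : ℕ, (Matrix.mvPolynomialX ι ι k).det ^ N ∈ relationIdeal a b := by
  change _ ∈ (relationIdeal a b).radical
  rw [← vanishingIdeal_zeroLocus_eq_radical (K := k)]
  intro p hp
  by_contra hdet
  exact h (exists_algEquiv_of_mem_zeroLocus a b hp hdet)

end Points

/-! ### Tensor powers of the antisymmetric tensor of top degree -/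

section Antisymmetric

variable {ι : Type*} [Fintype ι] [DecidableEq ι]

/-- The product of the Leibniz formulas for `N` determinants, multiplied out; the bijection `c`
numbers the factors of each term. -/
theorem prod_det_eq_sum {R : Type*} [CommRing R] {N n : ℕ} (c : Fin N × ι ≃ Fin n)
    (M : Fin N → Matrix ι ι R) :
    ∏ s, (M s).det = ∑ σ : Fin N → Equiv.Perm ι, (∏ s, ((σ s).sign : ℤ)) •
      ∏ t, M (c.symm t).1 (σ (c.symm t).1 (c.symm t).2) (c.symm t).2 := by
  simp only [Matrix.det_apply', Finset.prod_univ_sum, Fintype.piFinset_univ,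
    Finset.prod_mul_distrib, zsmul_eq_mul, Int.cast_prod]
  refine Finset.sum_congr rfl fun σ _ => ?_
  rw [← Fintype.prod_prod_type' fun s i => M s (σ s i) i]
  exact congrArg _ (Fintype.prod_equiv c _ _ fun t => by simp)

variable {k : Type u} [Field k] {A B : Type v}
  [NonUnitalCommRing A] [Module k A] [IsScalarTower k A A] [SMulCommClass k A A]
  [NonUnitalCommRing B] [Module k B] [IsScalarTower k B B] [SMulCommClass k B B]

/-- The `N`-th tensor power of the antisymmetric tensor `∑ σ, sign σ • ⨂ i, a (σ i)`, as a tensor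
over `Fin n`; the bijection `c` numbers the factors. -/
noncomputable def antisymmTensor (a : Basis ι k A) {N n : ℕ} (c : Fin N × ι ≃ Fin n) :
    ⨂[k] _ : Fin n, A :=
  ∑ σ : Fin N → Equiv.Perm ι, (∏ s, ((σ s).sign : ℤ)) •
    PiTensorProduct.tprod k fun t => a (σ (c.symm t).1 (c.symm t).2)

theorem antisymmTensor_ne_zero (a : Basis ι k A) {N n : ℕ} (c : Fin N × ι ≃ Fin n) :
    antisymmTensor a c ≠ 0 := by
  intro h
  -- The coordinate at `(⨂ i, a i)^{⊗N}` is `(det 1)^N`, written out by the Leibniz formula.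
  have h₁ := congrArg (tensorCoord a fun t => (c.symm t).2) h
  have h₂ := prod_det_eq_sum c fun _ => (1 : Matrix ι ι k)
  simp only [antisymmTensor, map_sum, map_zsmul, tensorCoord_tprod, Basis.repr_self,
    Finsupp.single_apply, map_zero] at h₁
  simp only [Matrix.det_one, Matrix.one_apply, Finset.prod_const_one] at h₂
  exact one_ne_zero (h₂.trans h₁)

/-- The coordinates of the image of `antisymmTensor a c` are the values of the functional at
products of `N` determinants of square matrices formed by columns of the generic matrix, where
columns may be repeated. -/
theorem tensorCoord_component_antisymmTensor (a : Basis ι k A) (b : Basis ι k B)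
    (η : functor k A ⟶ functor k B) {N n : ℕ} (c : Fin N × ι ≃ Fin n) (f : Fin n → ι) :
    tensorCoord b f (component η n (antisymmTensor a c)) = functional a b η
      (∏ s, ((Matrix.mvPolynomialX ι ι k).submatrix id fun i => f (c (s, i))).det) := by
  simp only [prod_det_eq_sum c, antisymmTensor, map_sum, map_zsmul, Matrix.submatrix_apply,
    Matrix.mvPolynomialX_apply, id_eq, Prod.mk.eta, Equiv.apply_symm_apply]
  refine Finset.sum_congr rfl fun σ _ => congrArg _ ?_
  exact (functional_prod_X a b η fun t => (σ (c.symm t).1 (c.symm t).2, f t)).symm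

theorem det_pow_dvd_prod_det_submatrix {R : Type*} [CommRing R] {N : ℕ} (X : Matrix ι ι R)
    (f : Fin N → ι → ι) : X.det ^ N ∣ ∏ s, (X.submatrix id (f s)).det := by
  have (s : Fin N) : X.det ∣ (X.submatrix id (f s)).det := by
    have : X.submatrix id (f s) = X * (1 : Matrix ι ι R).submatrix id (f s) := by
      ext i j
      simp [Matrix.mul_apply, Matrix.one_apply]
    rw [this, Matrix.det_mul]
    exact dvd_mul_right _ _
  simpa using Finset.prod_dvd_prod_of_dvd (fun _ => X.det) _ fun s (_ : s ∈ Finset.univ) => this s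

theorem component_antisymmTensor_eq_zero (a : Basis ι k A) (b : Basis ι k B)
    (η : functor k A ⟶ functor k B) {N n : ℕ} (c : Fin N × ι ≃ Fin n)
    (hN : (Matrix.mvPolynomialX ι ι k).det ^ N ∈ relationIdeal a b) :
    component η n (antisymmTensor a c) = 0 :=
  eq_zero_of_tensorCoord b fun f => by
    rw [tensorCoord_component_antisymmTensor]
    exact functional_eq_zero_of_mem a b η
      (Ideal.mem_of_dvd _ (det_pow_dvd_prod_det_submatrix _ fun s i => f (c (s, i))) hN)

end Antisymmetric

/-! ### The algebra isomorphism obtained from a natural isomorphism -/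

section Iso

variable {k : Type u} [Field k] {A B : Type v}
  [NonUnitalCommRing A] [Module k A] [IsScalarTower k A A] [SMulCommClass k A A]
  [NonUnitalCommRing B] [Module k B] [IsScalarTower k B B] [SMulCommClass k B B]

/-- A natural isomorphism `L_A ≅ L_B` gives a linear equivalence `A ≃ B`, its component at the
one-point set; it need not be multiplicative. -/
noncomputable def linearEquivOfIso (η : functor k A ≅ functor k B) : A ≃ₗ[k] B :=
  (PiTensorProduct.subsingletonEquiv (s := fun _ : Fin 1 => A) 0).symm ≪≫ₗ
    LinearEquiv.ofLinearMap (component η.hom 1) (component η.inv 1)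
      (LinearMap.ext (component_comp_inv η 1)) (LinearMap.ext (component_inv_comp η 1)) ≪≫ₗ
    PiTensorProduct.subsingletonEquiv (s := fun _ : Fin 1 => B) 0

/-- If no linear bijection `A → B` were multiplicative, the injective components of `η` would kill
a nonzero tensor power of the antisymmetric tensor. -/
theorem exists_algEquiv_of_iso [IsAlgClosed k] [FiniteDimensional k A]
    (η : functor k A ≅ functor k B) :
    ∃ e : A ≃ₗ[k] B, ∀ x y : A, e (x * y) = e x * e y := by
  by_contra h
  let a := finBasis k A
  let b := a.map (linearEquivOfIso η)
  obtain ⟨N, hN⟩ := exists_det_pow_mem a b h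
  refine antisymmTensor_ne_zero a (finProdFinEquiv (m := N)) ?_
  rw [← component_inv_comp η _ (antisymmTensor a _),
    component_antisymmTensor_eq_zero a b η.hom _ hN, map_zero]

end Iso

end Loday

theorem mainTheorem1 {k : Type u} [Field k] [IsAlgClosed k]
    {A B : Type v}
    [NonUnitalCommRing A] [Module k A] [IsScalarTower k A A] [SMulCommClass k A A]
    [NonUnitalCommRing B] [Module k B] [IsScalarTower k B B] [SMulCommClass k B B]
    [FiniteDimensional k A] [FiniteDimensional k B] :
    Nonempty (Loday.functor k A ≅ Loday.functor k B) ↔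
      ∃ e : A ≃ₗ[k] B, ∀ x y : A, e (x * y) = e x * e y :=
  ⟨fun ⟨η⟩ => Loday.exists_algEquiv_of_iso η, fun ⟨e, he⟩ => Loday.nonempty_iso_of_algEquiv e he⟩
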